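/- Let $\mathcal M$ be a type II$_1$ factor (a von Neumann algebra acting on a complex Hilbert space whose center consists of the scalar multiples of $1\neq 0$, in which every isometry is unitary, and which has no minimal projection), and let $\tau$ be its tracial state. For $k\ge 1$ let $\mathfrak E_k$ be the collection of all families $\{p_j\}_{j=1}^k$ of mutually orthogonal projections of $\mathcal M$ with $\tau(p_j)=1/k$ for each $j$. For $x_1,\dots,x_n\in\mathcal M$ and $\{p_j\}_{j=1}^k\in\mathfrak E_k$ put $$\mathcal I(x_1,\dots,x_n;\{p_j\}_{j=1}^k)=\sum_{m=1}^n\frac{|\{(i,j): p_ix_mp_j\ne 0\}|}{k^2},\qquad \mathcal I(x_1,\dots,x_n;k)=\inf_{\{p_j\}\in\mathfrak E_k}\mathcal I(x_1,\dots,x_n;\{p_j\}_{j=1}^k).$$ Let $\mathcal G(\mathcal M;k)\in[0,\infty]$ be the infimum of $\mathcal I(x_1,\dots,x_n;k)$ over all finite families $x_1,\dots,x_n$ that generate $\mathcal M$ as a von Neumann algebra ($\infty$ if $\mathcal M$ is not finitely generated), and let $$\mathcal G(\mathcal M)=\liminf_{k\to\infty}\mathcal G(\mathcal M;k).$$ If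 $\mathcal G(\mathcal M)<\tfrac14$, then $\mathcal M$ is singly generated: there is an element $x\in\mathcal M$ that generates $\mathcal M$ as a von Neumann algebra; equivalently, there are two self-adjoint elements of $\mathcal M$ that together generate $\mathcal M$ as a von Neumann algebra. -/

import Mathlib

open scoped ENNReal

namespace VonNeumannAlgebra

variable {H : Type*} [NormedAddCommGroup H] [InnerProductSpace ℂ H] [CompleteSpace H]

/-- A von Neumann algebra `M`, viewed as a unital *-algebra over `ℂ` in its own right. -/
abbrev Elem (M : VonNeumannAlgebra H) : Type _ := M.toStarSubalgebra

/-- `M` is a factor: it is not the zero algebra and every central element of `M` is a scalar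
multiple of the identity. -/
structure IsFactor (M : VonNeumannAlgebra H) : Prop where
  one_ne_zero : (1 : M.Elem) ≠ 0
  center_trivial : ∀ z : M.Elem, (∀ x : M.Elem, z * x = x * z) → ∃ c : ℂ, z = c • (1 : M.Elem)

/-- `M` is finite: every isometry in `M` is unitary, i.e. the identity is not Murray-von Neumann
equivalent to a proper subprojection. -/
def IsFiniteAlg (M : VonNeumannAlgebra H) : Prop :=
  ∀ v : M.Elem, star v * v = 1 → v * star v = 1

/-- `M` is diffuse: it has no minimal projection, i.e. every nonzero projection `p` of `M` has a
subprojection `q` in `M` other than `0` and `p`. For projections, `q ≤ p` means `p * q = q`. -/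
def IsDiffuse (M : VonNeumannAlgebra H) : Prop :=
  ∀ p : M.Elem, IsStarProjection p → p ≠ 0 →
    ∃ q : M.Elem, IsStarProjection q ∧ p * q = q ∧ q ≠ 0 ∧ q ≠ p

/-- A type II₁ factor: a finite factor without minimal projections. -/
structure IsTypeIIOneFactor (M : VonNeumannAlgebra H) : Prop where
  isFactor : M.IsFactor
  isFiniteAlg : M.IsFiniteAlg
  isDiffuse : M.IsDiffuse

/-- A tracial state on `M`: a positive linear functional with `τ 1 = 1` and `τ (xy) = τ (yx)`.
(On a type II₁ factor there is exactly one, and it is automatically faithful and normal.) -/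
structure TracialState (M : VonNeumannAlgebra H) where
  toLinearMap : M.Elem →ₗ[ℂ] ℂ
  map_one : toLinearMap 1 = 1
  nonneg : ∀ x : M.Elem, 0 ≤ (toLinearMap (star x * x)).re ∧ (toLinearMap (star x * x)).im = 0
  map_mul_comm : ∀ x y : M.Elem, toLinearMap (x * y) = toLinearMap (y * x)

/-- The set `S` of elements of `M` generates `M` as a von Neumann algebra: `M` is the smallest von
Neumann algebra on `H` that contains `S`. -/
def IsGeneratedBy (M : VonNeumannAlgebra H) (S : Set M.Elem) : Prop :=
  ∀ N : VonNeumannAlgebra H, (∀ x ∈ S, (x : H →L[ℂ] H) ∈ N) → M ≤ N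

/-- `M` is generated as a von Neumann algebra by one element. -/
def IsSinglyGenerated (M : VonNeumannAlgebra H) : Prop :=
  ∃ x : M.Elem, M.IsGeneratedBy {x}

/-- The collection `𝔈ₖ` of families `p₁, …, pₖ` of mutually orthogonal projections of `M` with
`τ (pⱼ) = 1 / k` for each `j`. -/
def equalFamilies (M : VonNeumannAlgebra H) (τ : M.TracialState) (k : ℕ) :
    Set (Fin k → M.Elem) :=
  {p | (∀ j, IsStarProjection (p j)) ∧ (∀ i j, i ≠ j → p i * p j = 0) ∧
    ∀ j, τ.toLinearMap (p j) = 1 / (k : ℂ)}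

/-- `ℐ(x; {pⱼ}) = |{(i, j) | pᵢ x pⱼ ≠ 0}| / k²`. -/
noncomputable def matricialSize (M : VonNeumannAlgebra H) {k : ℕ} (x : M.Elem)
    (p : Fin k → M.Elem) : ℝ≥0∞ :=
  (Nat.card {ij : Fin k × Fin k // p ij.1 * x * p ij.2 ≠ 0} : ℝ≥0∞) / (k : ℝ≥0∞) ^ 2

/-- `ℐ(x₁, …, xₙ; k)`: the infimum over all families in `𝔈ₖ` of
`ℐ(x₁, …, xₙ; {pⱼ}) = ∑ₘ ℐ(xₘ; {pⱼ})`. -/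
noncomputable def tupleSize (M : VonNeumannAlgebra H) (τ : M.TracialState) {n : ℕ}
    (x : Fin n → M.Elem) (k : ℕ) : ℝ≥0∞ :=
  ⨅ p ∈ M.equalFamilies τ k, ∑ m, M.matricialSize (x m) p

/-- `𝒢(M; k)`: the infimum of `ℐ(x₁, …, xₙ; k)` over all finite tuples generating `M` as a von
Neumann algebra; it is `∞` (an infimum over nothing) if `M` is not finitely generated. -/
noncomputable def genInvariantAt (M : VonNeumannAlgebra H) (τ : M.TracialState) (k : ℕ) : ℝ≥0∞ :=
  ⨅ (n : ℕ) (x : Fin n → M.Elem) (_ : M.IsGeneratedBy (Set.range x)), M.tupleSize τ x k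

/-- The invariant `𝒢(M) = liminf_{k → ∞} 𝒢(M; k)`, with values in `[0, ∞]`. -/
noncomputable def genInvariant (M : VonNeumannAlgebra H) (τ : M.TracialState) : ℝ≥0∞ :=
  Filter.liminf (fun k : ℕ => M.genInvariantAt τ k) Filter.atTop

end VonNeumannAlgebra

/-! A value below 1/4 gives, for some `k ≥ 6`, a generating tuple and projections `p i` of trace
`1/k` such that the tuple has fewer than `k²/4` nonzero blocks `p i * x m * p j` in all. In a finite
factor, projections of equal trace are equivalent (`TracialState.exists_equivalence`), so there are
matrix units `u i * star (u j)` over the diagonal `p`, and a block can be moved to any slot of the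
`k × k` matrix and back.

There are `(k-1)(k-2)/2 ≥ k²/4` slots strictly above the superdiagonal, so every block gets a slot
of its own. Let `C` carry these blocks together with the matrix units on the superdiagonal. The
self-adjoint elements `a = ∑ i • p i` and `b = C + star C` suffice: `a` yields each `p i` by
interpolation, compressing `b` yields the entries of `C`, the superdiagonal yields all matrix units,
and these return the blocks to their places (`exists_selfAdjoint_pair_of_blocks`). Then `a + I • b`
is a single generator.

The analytic input is polar decomposition, comparison of projections, and faithfulness of the trace
on projections. -/

namespace VonNeumannAlgebra

/-! ### Polar decomposition, strong sums and central projections -/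

section Operators

variable {H : Type*} [NormedAddCommGroup H] [InnerProductSpace ℂ H] [CompleteSpace H]

/-- An operator vanishing on the range and on the kernel of a self-adjoint operator is zero. -/
theorem eq_zero_of_mul_eq_zero_of_ker {h T : H →L[ℂ] H} (hh : IsSelfAdjoint h)
    (hT : T * h = 0) (hk : ∀ ξ, h ξ = 0 → T ξ = 0) : T = 0 := by
  have h1 : h * star T = 0 := by
    have := congrArg star hT
    simpa [hh.star_eq] using this
  have h2 : T * star T = 0 := by
    ext ξ
    exact hk _ (by simpa using congrArg (fun S : H →L[ℂ] H => S ξ) h1)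
  exact CStarRing.mul_star_self_eq_zero_iff T |>.1 h2

/-- The partial isometry of the polar decomposition of an operator. -/
theorem exists_polar (x : H →L[ℂ] H) :
    ∃ v : H →L[ℂ] H, v * CFC.abs x = x ∧ ∀ ξ, CFC.abs x ξ = 0 → v ξ = 0 := by
  set h : H →L[ℂ] H := CFC.abs x
  have hsa : IsSelfAdjoint h := (CFC.abs_nonneg x).isSelfAdjoint
  have hh : h * h = star x * x := CFC.abs_mul_abs x
  have hnorm (ξ : H) : ‖h ξ‖ = ‖x ξ‖ := by
    have h1 : inner ℂ (h ξ) (h ξ) = inner ℂ (x ξ) (x ξ) := by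
      rw [← ContinuousLinearMap.adjoint_inner_left, ← ContinuousLinearMap.adjoint_inner_left,
        ← ContinuousLinearMap.star_eq_adjoint, ← ContinuousLinearMap.star_eq_adjoint, hsa.star_eq]
      exact congrArg (fun S : H →L[ℂ] H => inner ℂ (S ξ) ξ) hh
    rw [inner_self_eq_norm_sq_to_K, inner_self_eq_norm_sq_to_K] at h1
    have h2 : ‖h ξ‖ ^ 2 = ‖x ξ‖ ^ 2 := by exact_mod_cast h1
    exact (pow_left_inj₀ (norm_nonneg _) (norm_nonneg _) two_ne_zero).1 h2
  have horth (ξ η : H) (hη : h η = 0) : inner ℂ (h ξ) η = 0 := by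
    rw [← hsa.star_eq, ContinuousLinearMap.star_eq_adjoint,
      ContinuousLinearMap.adjoint_inner_left, hη, inner_zero_right]
  -- The map `v` extends `f` along `e`, that is `h ξ + η ↦ x ξ` for `η` in the kernel of `h`. It is
  -- contractive by Pythagoras, and `e` has dense range because the complement of the range of `h`
  -- is its kernel.
  let K : Submodule ℂ H := h.ker
  let e : H × K →ₗ[ℂ] H := (h : H →ₗ[ℂ] H).coprod K.subtype
  let f : H × K →ₗ[ℂ] H := (x : H →ₗ[ℂ] H) ∘ₗ LinearMap.fst ℂ H K
  have hfe : ∀ z, ‖f z‖ ≤ 1 * ‖e z‖ := by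
    rintro ⟨ξ, η, hη⟩
    have h1 : ‖h ξ + η‖ * ‖h ξ + η‖ = ‖h ξ‖ * ‖h ξ‖ + ‖η‖ * ‖η‖ :=
      norm_add_sq_eq_norm_sq_add_norm_sq_of_inner_eq_zero _ _ (horth ξ η hη)
    simp only [f, e, one_mul, LinearMap.coe_comp, Function.comp_apply, LinearMap.fst_apply,
      LinearMap.coprod_apply, ContinuousLinearMap.coe_coe, Submodule.subtype_apply, ← hnorm]
    nlinarith [norm_nonneg (h ξ), norm_nonneg (h ξ + η), norm_nonneg η]
  have hdense : DenseRange e := by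
    have : Dense ((LinearMap.range e : Submodule ℂ H) : Set H) := by
      rw [Submodule.dense_iff_topologicalClosure_eq_top, Submodule.topologicalClosure_eq_top_iff,
        Submodule.eq_bot_iff]
      intro y hy
      rw [Submodule.mem_orthogonal] at hy
      have hy1 (ξ : H) : inner ℂ (h ξ) y = 0 := hy _ ⟨(ξ, 0), by simp [e]⟩
      have hy2 : h y = 0 := by
        have := hy1 (h y)
        rwa [← ContinuousLinearMap.adjoint_inner_right, ← ContinuousLinearMap.star_eq_adjoint,
          hsa.star_eq, inner_self_eq_zero] at this
      exact inner_self_eq_zero.1 (hy y ⟨(0, ⟨y, hy2⟩), by simp [e]⟩)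
    simpa only [DenseRange, LinearMap.coe_range] using this
  refine ⟨f.extendOfNorm e, ?_, ?_⟩
  · ext ξ
    have := LinearMap.extendOfNorm_eq (f := f) hdense ⟨1, hfe⟩ (ξ, 0)
    simpa [e, f] using this
  · intro ξ hξ
    have := LinearMap.extendOfNorm_eq (f := f) hdense ⟨1, hfe⟩ (0, ⟨ξ, hξ⟩)
    simpa [e, f] using this

theorem mem_iff_commute_commutant {M : VonNeumannAlgebra H} {x : H →L[ℂ] H} :
    x ∈ M ↔ ∀ t ∈ M.commutant, t * x = x * t := by
  conv_lhs => rw [← M.commutant_commutant]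
  exact mem_commutant_iff

/-- The polar part commutes with the commutant because it does so on the range and the kernel of
`|x|`. The annihilator conditions stand in for support projections. -/
theorem exists_partialIsometry (M : VonNeumannAlgebra H) {x : H →L[ℂ] H} (hx : x ∈ M) :
    ∃ v ∈ M, v * star v * v = v ∧ (v = 0 → x = 0) ∧ (∀ y, y * x = 0 → y * v = 0) ∧
      ∀ y, x * y = 0 → v * y = 0 := by
  obtain ⟨v, hv, hvk⟩ := exists_polar x
  set h : H →L[ℂ] H := CFC.abs x
  have hsa : IsSelfAdjoint h := (CFC.abs_nonneg x).isSelfAdjoint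
  have hh : h * h = star x * x := CFC.abs_mul_abs x
  have hker (y : H →L[ℂ] H) (hy : h * y = 0) : v * y = 0 := by
    ext ξ
    exact hvk _ (by simpa using congrArg (fun S : H →L[ℂ] H => S ξ) hy)
  refine ⟨v, ?_, ?_, ?_, ?_, ?_⟩
  · rw [mem_iff_commute_commutant]
    intro t ht
    have htx : t * x = x * t := mem_iff_commute_commutant.1 hx t ht
    have htx' : t * star x = star x * t := mem_iff_commute_commutant.1 (star_mem hx) t ht
    have hth : t * h = h * t := by
      have h0 : Commute (star x * x) t := by
        change star x * x * t = t * (star x * x)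
        rw [mul_assoc, ← htx, ← mul_assoc, ← htx', mul_assoc]
      exact (Commute.cfcₙ_nnreal h0 _).eq.symm
    rw [← sub_eq_zero]
    refine eq_zero_of_mul_eq_zero_of_ker hsa ?_ ?_
    · rw [sub_mul, mul_assoc, hv, mul_assoc, hth, ← mul_assoc, hv, htx, sub_self]
    · intro ξ hξ
      have : h (t ξ) = 0 := by
        have := congrArg (fun S : H →L[ℂ] H => S ξ) hth
        simpa [hξ] using this.symm
      simp [hvk _ hξ, hvk _ this]
  -- Write `D` for the left side. Since `h * D = 0`, also `v * D = 0`, and `star D * D = h * star v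
  -- * (v * D) - h * D` vanishes.
  · have hD : star v * v * h - h = 0 := by
      have h1 : h * (star v * v * h) = h * h := by
        have h2 : h * star v = star x := by
          have := congrArg star hv
          simpa [hsa.star_eq] using this
        rw [mul_assoc, hv, ← mul_assoc, h2, hh]
      have h3 : h * (star v * v * h - h) = 0 := by rw [mul_sub, h1, sub_self]
      rw [← CStarRing.star_mul_self_eq_zero_iff]
      calc star (star v * v * h - h) * (star v * v * h - h)
          = h * star v * (v * (star v * v * h - h)) - h * (star v * v * h - h) := by
            simp only [star_sub, star_mul, star_star, hsa.star_eq]; noncomm_ring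
        _ = 0 := by rw [hker _ h3, h3]; simp
    rw [← sub_eq_zero]
    refine eq_zero_of_mul_eq_zero_of_ker hsa ?_ ?_
    · calc (v * star v * v - v) * h = v * (star v * v * h - h) := by noncomm_ring
        _ = 0 := by rw [hD, mul_zero]
    · intro ξ hξ
      simp [hvk ξ hξ]
  · rintro rfl
    rw [← hv, zero_mul]
  · intro y hy
    refine eq_zero_of_mul_eq_zero_of_ker hsa ?_ ?_
    · rw [mul_assoc, hv, hy]
    · intro ξ hξ
      simp [hvk ξ hξ]
  · intro y hy
    apply hker
    rw [← CStarRing.star_mul_self_eq_zero_iff, star_mul, hsa.star_eq, mul_assoc, ← mul_assoc h,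
      hh, mul_assoc, hy, mul_zero, mul_zero]

theorem norm_le_one_of_mul_star_mul_self {v : H →L[ℂ] H} (hv : v * star v * v = v) : ‖v‖ ≤ 1 := by
  have h1 : ‖v‖ ≤ ‖v‖ * ‖v‖ * ‖v‖ := by
    calc ‖v‖ = ‖v * star v * v‖ := by rw [hv]
      _ ≤ ‖v * star v‖ * ‖v‖ := norm_mul_le _ _
      _ = ‖v‖ * ‖v‖ * ‖v‖ := by rw [CStarRing.norm_self_mul_star]
  have h2 : ‖v‖ * ‖v‖ ≤ 1 := by
    have : star (star v * v) * (star v * v) = star v * v := by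
      rw [star_mul, star_star, mul_assoc, ← mul_assoc v, hv]
    have h3 := CStarRing.norm_star_mul_self (x := star v * v)
    rw [this, CStarRing.norm_star_mul_self] at h3
    by_contra! hc
    nlinarith
  nlinarith [norm_nonneg v]

/-- Mutually orthogonal partial isometries sum strongly to an operator. -/
theorem exists_hasSum_of_orthogonal {ι : Type*} (v : ι → H →L[ℂ] H)
    (hv : ∀ i, v i * star (v i) * v i = v i)
    (hl : ∀ i j, i ≠ j → star (v i) * v j = 0) (hr : ∀ i j, i ≠ j → v i * star (v j) = 0) :
    ∃ w : H →L[ℂ] H, ∀ ξ, HasSum (fun i => v i ξ) (w ξ) := by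
  classical
  -- Finite partial sums are again partial isometries, hence contractions; with orthogonality of the
  -- ranges this bounds `∑ ‖v i ξ‖²`.
  have hF (F : Finset ι) : ‖∑ i ∈ F, v i‖ ≤ 1 := by
    apply norm_le_one_of_mul_star_mul_self
    have h1 : (∑ i ∈ F, v i) * star (∑ i ∈ F, v i) = ∑ i ∈ F, v i * star (v i) := by
      rw [star_sum, Finset.sum_mul_sum]
      refine Finset.sum_congr rfl fun i hi => Finset.sum_eq_single_of_mem i hi fun j _ hj => ?_
      exact hr _ _ hj.symm
    rw [h1, Finset.sum_mul_sum]
    refine Finset.sum_congr rfl fun i hi => ?_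
    rw [Finset.sum_eq_single_of_mem i hi, hv]
    intro j _ hj
    rw [mul_assoc, hl _ _ hj.symm, mul_zero]
  have hFξ (F : Finset ι) (ξ : H) : ‖∑ i ∈ F, v i ξ‖ ≤ ‖ξ‖ := by
    have := (∑ i ∈ F, v i).le_of_opNorm_le (hF F) ξ
    simpa using this
  have horth : OrthogonalFamily ℂ (fun i => (v i).range)
      (fun i => (v i).range.subtypeₗᵢ) := by
    rintro i j hij ⟨_, ξ, rfl⟩ ⟨_, η, rfl⟩
    change inner ℂ (v i ξ) (v j η) = 0
    rw [← ContinuousLinearMap.adjoint_inner_right, ← ContinuousLinearMap.star_eq_adjoint]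
    have : star (v i) (v j η) = 0 := congrArg (fun S : H →L[ℂ] H => S η) (hl i j hij)
    rw [this, inner_zero_right]
  have hsum (ξ : H) : Summable fun i => v i ξ := by
    have := (horth.summable_iff_norm_sq_summable fun i => ⟨v i ξ, ξ, rfl⟩).2 ?_
    · exact this
    · refine summable_of_sum_le (c := ‖ξ‖ ^ 2) (fun i => by positivity) fun F => ?_
      have h1 := horth.norm_sum (fun i => ⟨v i ξ, ξ, rfl⟩) F
      rw [← h1]
      exact pow_le_pow_left₀ (norm_nonneg _) (hFξ F ξ) 2
  let w : H →ₗ[ℂ] H :=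
    { toFun := fun ξ => ∑' i, v i ξ
      map_add' := fun ξ η => by
        simp only [map_add]; exact (hsum ξ).tsum_add (hsum η)
      map_smul' := fun c ξ => by
        simp only [map_smul, RingHom.id_apply]; exact (hsum ξ).tsum_const_smul c }
  refine ⟨w.mkContinuous 1 fun ξ => ?_, fun ξ => (hsum ξ).hasSum⟩
  rw [one_mul]
  exact le_of_tendsto (hsum ξ).hasSum.norm (Filter.Eventually.of_forall fun F => hFξ F ξ)

variable (M : VonNeumannAlgebra H)

/-- The strong sum of mutually orthogonal partial isometries of `M`, as an element of `M`. -/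
theorem exists_strongSum {ι : Type*} (v : ι → M.Elem)
    (hv : ∀ i, v i * star (v i) * v i = v i)
    (hl : ∀ i j, i ≠ j → star (v i) * v j = 0) (hr : ∀ i j, i ≠ j → v i * star (v j) = 0) :
    ∃ w : M.Elem, w * star w * w = w ∧ (∀ i, w * star (v i) = v i * star (v i)) ∧
      (∀ i, star w * v i = star (v i) * v i) ∧ (∀ y, (∀ i, v i * y = 0) → w * y = 0) ∧
      ∀ y, (∀ i, y * v i = 0) → y * w = 0 := by
  obtain ⟨w, hw⟩ := exists_hasSum_of_orthogonal (fun i => (v i : H →L[ℂ] H))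
    (fun i => congrArg Subtype.val (hv i)) (fun i j hij => congrArg Subtype.val (hl i j hij))
    (fun i j hij => congrArg Subtype.val (hr i j hij))
  have hwM : w ∈ M := by
    rw [mem_iff_commute_commutant]
    intro t ht
    ext ξ
    have h1 : HasSum (fun i => t ((v i : H →L[ℂ] H) ξ)) (t (w ξ)) := (hw ξ).mapL t
    have h2 : (fun i => t ((v i : H →L[ℂ] H) ξ)) = fun i => (v i : H →L[ℂ] H) (t ξ) :=
      funext fun i => congrArg (fun S : H →L[ℂ] H => S ξ)
        (mem_iff_commute_commutant.1 (v i).2 t ht)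
    rw [h2] at h1
    exact h1.unique (hw (t ξ))
  -- Multiplication on both sides passes through the strong sum; the case of a single surviving term
  -- is all that is needed.
  have hmul (y z a : M.Elem) (i : ι) (h1 : ∀ j, j ≠ i → y * v j * z = 0)
      (h2 : y * v i * z = a) : y * (⟨w, hwM⟩ : M.Elem) * z = a := by
    apply Subtype.ext
    ext ξ
    have h3 : HasSum (fun j => (y : H →L[ℂ] H) ((v j : H →L[ℂ] H) ((z : H →L[ℂ] H) ξ)))
        ((y : H →L[ℂ] H) (w ((z : H →L[ℂ] H) ξ))) := (hw _).mapL (y : H →L[ℂ] H)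
    have h4 := hasSum_single
      (f := fun j => (y : H →L[ℂ] H) ((v j : H →L[ℂ] H) ((z : H →L[ℂ] H) ξ))) i
      fun j hj => congrArg (fun S : M.Elem => (S : H →L[ℂ] H) ξ) (h1 j hj)
    rw [← h2]
    exact h3.unique h4
  have hmul_zero (y z : M.Elem) (h1 : ∀ j, y * v j * z = 0) :
      y * (⟨w, hwM⟩ : M.Elem) * z = 0 := by
    rcases isEmpty_or_nonempty ι with hι | ⟨⟨i⟩⟩
    · apply Subtype.ext
      ext ξ
      have h3 : w ((z : H →L[ℂ] H) ξ) = 0 := (hw _).unique hasSum_empty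
      change (y : H →L[ℂ] H) (w ((z : H →L[ℂ] H) ξ)) = 0
      rw [h3, map_zero]
    · exact hmul y z 0 i (fun j _ => h1 j) (h1 i)
  have h1 (i : ι) : (⟨w, hwM⟩ : M.Elem) * star (v i) = v i * star (v i) := by
    have := hmul 1 (star (v i)) (v i * star (v i)) i
      (fun j hj => by rw [one_mul, hr _ _ hj]) (by rw [one_mul])
    rwa [one_mul] at this
  have h2 (i : ι) : star (⟨w, hwM⟩ : M.Elem) * v i = star (v i) * v i := by
    have := hmul (star (v i)) 1 (star (v i) * v i) i
      (fun j hj => by rw [mul_one, hl _ _ hj.symm]) (by rw [mul_one])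
    rw [mul_one] at this
    simpa using congrArg star this
  have h3 (y : M.Elem) (h : ∀ i, v i * y = 0) : (⟨w, hwM⟩ : M.Elem) * y = 0 := by
    simpa using hmul_zero 1 y (by simpa using h)
  have h4 (y : M.Elem) (h : ∀ i, y * v i = 0) : y * (⟨w, hwM⟩ : M.Elem) = 0 := by
    simpa using hmul_zero y 1 (by simpa using h)
  refine ⟨⟨w, hwM⟩, ?_, h1, h2, h3, h4⟩
  rw [← sub_eq_zero]
  set W : M.Elem := ⟨w, hwM⟩
  have : (W * star W - 1) * W = 0 := by
    apply h4
    intro i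
    have h5 : W * star (v i) * v i = v i := by rw [h1, hv]
    rw [sub_mul, one_mul, mul_assoc, h2, ← mul_assoc, h5, sub_self]
  rwa [sub_mul, one_mul] at this

variable {M}

/-- In a factor, two projections with `q M p = 0` cannot both be nonzero. -/
theorem IsFactor.eq_zero_or_eq_zero (hM : M.IsFactor) {p q : M.Elem}
    (h : ∀ y : M.Elem, q * y * p = 0) : p = 0 ∨ q = 0 := by
  -- `K` is closed and invariant under `M` and its commutant, so its projection is central, hence
  -- scalar. It contains the range of `p` and is annihilated by `q`.
  let K : Submodule ℂ H := ⨅ y : M.Elem, ((q * y : M.Elem) : H →L[ℂ] H).ker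
  have hK (ξ : H) : ξ ∈ K ↔ ∀ y : M.Elem, (q : H →L[ℂ] H) ((y : H →L[ℂ] H) ξ) = 0 := by
    simp [K, Submodule.mem_iInf]
  have hclosed : IsClosed (K : Set H) := by
    have : (K : Set H) = ⋂ y : M.Elem, {ξ | (q : H →L[ℂ] H) ((y : H →L[ℂ] H) ξ) = 0} := by
      ext ξ; simp only [SetLike.mem_coe, hK, Set.mem_iInter, Set.mem_ofPred_eq]
    rw [this]
    exact isClosed_iInter fun y => isClosed_eq (by fun_prop) continuous_const
  have : CompleteSpace K := hclosed.completeSpace_coe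
  have hinvM (x : H →L[ℂ] H) (hx : x ∈ M) : K ∈ Module.End.invtSubmodule x := by
    rw [Module.End.mem_invtSubmodule]
    intro ξ hξ
    rw [Submodule.mem_comap, hK]
    exact fun y => (hK ξ).1 hξ (y * (⟨x, hx⟩ : M.Elem))
  have hinvM' (x : H →L[ℂ] H) (hx : x ∈ M.commutant) : K ∈ Module.End.invtSubmodule x := by
    rw [Module.End.mem_invtSubmodule]
    intro ξ hξ
    rw [Submodule.mem_comap, hK]
    intro y
    have h1 : x * ((q : H →L[ℂ] H) * (y : H →L[ℂ] H)) = (q : H →L[ℂ] H) * (y : H →L[ℂ] H) * x :=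
      (mem_commutant_iff.1 hx _ (mul_mem q.2 y.2)).symm
    have h2 := congrArg (fun S : H →L[ℂ] H => S ξ) h1
    have h3 : (q : H →L[ℂ] H) ((y : H →L[ℂ] H) (x ξ)) = x ((q : H →L[ℂ] H) ((y : H →L[ℂ] H) ξ)) :=
      h2.symm
    change (q : H →L[ℂ] H) ((y : H →L[ℂ] H) (x ξ)) = 0
    rw [h3, (hK ξ).1 hξ y, map_zero]
  have hP : IsStarProjection K.starProjection := isStarProjection_starProjection
  have hPM : K.starProjection ∈ M := by
    rw [IsStarProjection.mem_iff hP]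
    intro y hy
    rw [Submodule.range_starProjection]
    exact hinvM' y hy
  have hPM' : K.starProjection ∈ M.commutant := by
    rw [IsStarProjection.mem_iff hP]
    intro y hy
    rw [Submodule.range_starProjection]
    exact hinvM y (by rwa [commutant_commutant] at hy)
  obtain ⟨c, hc⟩ := hM.center_trivial ⟨_, hPM⟩
    fun x => Subtype.ext (mem_commutant_iff.1 hPM' x x.2).symm
  have hPp : (⟨_, hPM⟩ : M.Elem) * p = p := by
    apply Subtype.ext
    ext ξ
    refine Submodule.starProjection_eq_self_iff.2 ?_
    rw [hK]
    intro y
    exact congrArg (fun S : M.Elem => (S : H →L[ℂ] H) ξ) (h y)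
  have hqP : q * (⟨_, hPM⟩ : M.Elem) = 0 := by
    apply Subtype.ext
    ext ξ
    exact (hK _).1 (Submodule.starProjection_apply_mem K ξ) 1
  have h1 : c • q = 0 := by rw [← hqP, hc]; simp
  rcases smul_eq_zero.1 h1 with rfl | hq
  · left
    rw [← hPp, hc]; simp
  · exact Or.inr hq

end Operators

/-! ### Comparison of projections and faithfulness of the trace -/

section Comparison

variable {H : Type*} [NormedAddCommGroup H] [InnerProductSpace ℂ H] [CompleteSpace H]
variable {M : VonNeumannAlgebra H}

theorem Elem.eq_zero_of_star_mul_self {x : M.Elem} (h : star x * x = 0) : x = 0 :=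
  Subtype.ext ((CStarRing.star_mul_self_eq_zero_iff (x : H →L[ℂ] H)).1 (congrArg Subtype.val h))

theorem Elem.exists_partialIsometry (x : M.Elem) :
    ∃ v : M.Elem, v * star v * v = v ∧ (v = 0 → x = 0) ∧ (∀ y, y * x = 0 → y * v = 0) ∧
      ∀ y, x * y = 0 → v * y = 0 := by
  obtain ⟨v, hv, h1, h2, h3, h4⟩ := M.exists_partialIsometry x.2
  refine ⟨⟨v, hv⟩, Subtype.ext h1, fun h => Subtype.ext (h2 (congrArg Subtype.val h)),
    fun y hy => Subtype.ext (h3 _ (congrArg Subtype.val hy)),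
    fun y hy => Subtype.ext (h4 _ (congrArg Subtype.val hy))⟩

/-- Murray-von Neumann comparison of projections in a factor. -/
theorem IsFactor.comparison (hM : M.IsFactor) {p q : M.Elem} (hp : IsStarProjection p)
    (hq : IsStarProjection q) :
    ∃ v : M.Elem, q * v = v ∧ v * p = v ∧ (star v * v = p ∨ v * star v = q) := by
  -- Zorn's lemma is applied to families of nonzero partial isometries from `p` into `q` with
  -- orthogonal initial and final spaces; `w` is the strong sum of a maximal family.
  let P : M.Elem → Prop := fun v => v ≠ 0 ∧ v * star v * v = v ∧ (1 - q) * v = 0 ∧ v * (1 - p) = 0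
  let F : Set (Set M.Elem) := {S | (∀ v ∈ S, P v) ∧
    ∀ v ∈ S, ∀ w ∈ S, v ≠ w → star v * w = 0 ∧ v * star w = 0}
  obtain ⟨S, hS⟩ : ∃ S, Maximal (· ∈ F) S := by
    refine zorn_subset F fun c hcF hc => ⟨⋃₀ c, ⟨?_, ?_⟩, fun s hs => Set.subset_sUnion_of_mem hs⟩
    · rintro v ⟨s, hs, hv⟩
      exact (hcF hs).1 v hv
    · rintro v ⟨s, hs, hv⟩ w ⟨t, ht, hw⟩ hvw
      rcases hc.total hs ht with h | h
      · exact (hcF ht).2 v (h hv) w hw hvw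
      · exact (hcF hs).2 v hv w (h hw) hvw
  obtain ⟨hSP, hSo⟩ := hS.prop
  obtain ⟨w, hw, hwr, hwl, hw0, hw0'⟩ := M.exists_strongSum (fun v : S => (v : M.Elem))
    (fun v => (hSP v v.2).2.1)
    (fun v w h => (hSo v v.2 w w.2 fun h' => h (Subtype.ext h')).1)
    (fun v w h => (hSo v v.2 w w.2 fun h' => h (Subtype.ext h')).2)
  have hqw : (1 - q) * w = 0 := hw0' _ fun v => (hSP v v.2).2.2.1
  have hwp : w * (1 - p) = 0 := hw0 _ fun v => (hSP v v.2).2.2.2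
  have hpw : (1 - p) * star w = 0 := by
    simpa [hp.isSelfAdjoint.star_eq] using congrArg star hwp
  have hwq : star w * (1 - q) = 0 := by
    simpa [hq.isSelfAdjoint.star_eq] using congrArg star hqw
  refine ⟨w, ?_, ?_, ?_⟩
  · rw [sub_mul, one_mul, sub_eq_zero] at hqw; exact hqw.symm
  · rw [mul_sub, mul_one, sub_eq_zero] at hwp; exact hwp.symm
  suffices h : p - star w * w = 0 ∨ q - w * star w = 0 by
    rcases h with h | h
    · exact Or.inl (sub_eq_zero.1 h).symm
    · exact Or.inr (sub_eq_zero.1 h).symm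
  -- If a corner between the two defects is nonzero, its polar part `u` enlarges the maximal family.
  refine hM.eq_zero_or_eq_zero fun y => ?_
  by_contra hx
  obtain ⟨u, hu, hu0, hul, hur⟩ := Elem.exists_partialIsometry ((q - w * star w) * y * (p - star w * w))
  have huS (v : M.Elem) (hv : v ∈ S) : star v * u = 0 ∧ u * star v = 0 := by
    obtain ⟨-, h1, h2, h3⟩ := hSP v hv
    have e1 : star v * (1 - q) = 0 := by
      simpa [hq.isSelfAdjoint.star_eq] using congrArg star h2
    have e2 : (1 - p) * star v = 0 := by
      simpa [hp.isSelfAdjoint.star_eq] using congrArg star h3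
    have e3 : star v * w = star v * v := by
      simpa using congrArg star (hwl ⟨v, hv⟩)
    have e4 : w * star v = v * star v := hwr ⟨v, hv⟩
    have e5 : star w * v = star v * v := hwl ⟨v, hv⟩
    have e6 : v * star w = v * star v := by simpa using congrArg star e4
    have e7 : star v * v * star v = star v := by
      simpa [mul_assoc] using congrArg star h1
    constructor
    · apply hul
      have : star v * (q - w * star w) = 0 := by
        have e8 : star v * w * star w = star v := by rw [e3, mul_assoc, e6, ← mul_assoc, e7]
        rw [mul_sub, ← mul_assoc, e8]
        rw [mul_sub, mul_one, sub_eq_zero] at e1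
        rw [← e1, sub_self]
      rw [mul_assoc (q - _), ← mul_assoc, this, zero_mul]
    · apply hur
      have : (p - star w * w) * star v = 0 := by
        have e8 : star w * w * star v = star v := by rw [mul_assoc, e4, ← mul_assoc, e5, e7]
        rw [sub_mul, e8]
        rw [sub_mul, one_mul, sub_eq_zero] at e2
        rw [← e2, sub_self]
      rw [mul_assoc, this, mul_zero]
  have hu_ne : u ≠ 0 := fun h => hx (hu0 h)
  have hPu : P u := by
    refine ⟨hu_ne, hu, hul _ ?_, hur _ ?_⟩
    · have : (1 - q) * (q - w * star w) = 0 := by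
        rw [mul_sub, hq.one_sub_mul_self, ← mul_assoc, hqw, zero_mul, sub_zero]
      rw [mul_assoc (q - _), ← mul_assoc, this, zero_mul]
    · have : (p - star w * w) * (1 - p) = 0 := by
        rw [sub_mul, hp.mul_one_sub_self, mul_assoc, hwp, mul_zero, sub_zero]
      rw [mul_assoc, this, mul_zero]
  have hins : insert u S ∈ F := by
    refine ⟨?_, ?_⟩
    · rintro v (rfl | hv)
      · exact hPu
      · exact hSP v hv
    · rintro v (rfl | hv) w (rfl | hw) hvw
      · exact absurd rfl hvw
      · exact ⟨by simpa using congrArg star (huS w hw).1, (huS w hw).2⟩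
      · exact ⟨(huS v hv).1, by simpa using congrArg star (huS v hv).2⟩
      · exact hSo v hv w hw hvw
  -- Now `u` lies in the family and is orthogonal to every member of it, so `star u * u = 0`.
  have huS' : u ∈ S := hS.le_of_ge hins (Set.subset_insert u S) (Set.mem_insert u S)
  exact hu_ne (Elem.eq_zero_of_star_mul_self (huS u huS').1)

variable (τ : M.TracialState)

theorem TracialState.re_nonneg_of_isStarProjection {p : M.Elem} (hp : IsStarProjection p) :
    0 ≤ (τ.toLinearMap p).re := by
  have := (τ.nonneg p).1
  rwa [hp.isSelfAdjoint.star_eq, hp.isIdempotentElem.eq] at this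

theorem isStarProjection_sub_mul_star {A : Type*} [Ring A] [StarRing A] {q v : A}
    (hq : IsStarProjection q) (h : q * v = v) (hv : v * star v * v = v) :
    IsStarProjection (q - v * star v) := by
  have h' : star v * q = star v := by simpa [hq.isSelfAdjoint.star_eq] using congrArg star h
  refine IsStarProjection.mk ?_ ?_
  · change (q - v * star v) * (q - v * star v) = q - v * star v
    have h2 : v * star v * (v * star v) = v * star v := by rw [← mul_assoc, hv]
    rw [sub_mul, mul_sub, mul_sub, hq.isIdempotentElem.eq, ← mul_assoc, h, mul_assoc v, h', h2,
      sub_self, sub_zero]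
  · exact hq.isSelfAdjoint.sub (IsSelfAdjoint.mul_star_self v)

/-- In a finite algebra a nonzero projection does not admit a sequence of orthogonal copies. -/
theorem IsFiniteAlg.eq_zero_of_sequence (hM : M.IsFiniteAlg) {r : M.Elem} (v : ℕ → M.Elem)
    (hr : ∀ n, star (v n) * v n = r) (hvr : ∀ n, v n * r = v n)
    (ho : ∀ m n, m ≠ n → star (v m) * v n = 0) : r = 0 := by
  -- This `w` is a unilateral shift along the copies of `r`. Completed by `1 - star w * w` it
  -- becomes an isometry whose range is orthogonal to that of `v 0`; finiteness forces `v 0 = 0`.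
  obtain ⟨w, hw, hwr, hwl, -, hw0⟩ := M.exists_strongSum (fun n => v (n + 1) * star (v n))
    (fun n => by
      calc v (n + 1) * star (v n) * star (v (n + 1) * star (v n)) * (v (n + 1) * star (v n))
          = v (n + 1) * (star (v n) * v n) * (star (v (n + 1)) * v (n + 1)) * star (v n) := by
            simp only [star_mul, star_star, mul_assoc]
        _ = v (n + 1) * star (v n) := by rw [hr, hr, hvr, hvr])
    (fun m n hmn => by
      calc star (v (m + 1) * star (v m)) * (v (n + 1) * star (v n))
          = v m * (star (v (m + 1)) * v (n + 1)) * star (v n) := by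
            simp only [star_mul, star_star, mul_assoc]
        _ = 0 := by rw [ho _ _ (by omega), mul_zero, zero_mul])
    (fun m n hmn => by
      calc v (m + 1) * star (v m) * star (v (n + 1) * star (v n))
          = v (m + 1) * (star (v m) * v n) * star (v (n + 1)) := by
            simp only [star_mul, star_star, mul_assoc]
        _ = 0 := by rw [ho _ _ hmn, mul_zero, zero_mul])
  have s1 (n : ℕ) : v (n + 1) * star (v n) * v n = v (n + 1) := by rw [mul_assoc, hr, hvr]
  have s2 (n : ℕ) : star (v (n + 1) * star (v n)) * v (n + 1) = v n := by
    rw [star_mul, star_star, mul_assoc, hr, hvr]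
  have w1 (n : ℕ) : w * v n = v (n + 1) := by
    conv_lhs => rw [← s2 n, ← mul_assoc, hwr, mul_assoc, s2, s1]
  have w2 (n : ℕ) : star w * v (n + 1) = v n := by
    conv_lhs => rw [← s1 n, ← mul_assoc, hwl, mul_assoc, s1, s2]
  have hfv (n : ℕ) : star w * w * v n = v n := by rw [mul_assoc, w1, w2]
  have hfw : (1 - star w * w) * w = 0 := by
    refine hw0 _ fun n => ?_
    rw [← mul_assoc, sub_mul, one_mul, hfv, sub_self, zero_mul]
  have hwf : star w * (1 - star w * w) = 0 := by simpa using congrArg star hfw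
  have hff : (1 - star w * w) * (1 - star w * w) = 1 - star w * w := by
    have : star w * w * (star w * w) = star w * w := by rw [mul_assoc, ← mul_assoc w, hw]
    rw [sub_mul, one_mul, mul_sub, mul_one, this, sub_self, sub_zero]
  have hiso : star (w + (1 - star w * w)) * (w + (1 - star w * w)) = 1 := by
    have : star (w + (1 - star w * w)) = star w + (1 - star w * w) := by simp
    rw [this, add_mul, mul_add, mul_add, hwf, hfw, hff]
    abel
  have huni := hM _ hiso
  have hv0 : star w * v 0 = 0 := by
    have : star (v 0) * w = 0 := hw0 _ fun n => by
      rw [← mul_assoc, ho _ _ (by omega), zero_mul]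
    simpa using congrArg star this
  have h1 : star (w + (1 - star w * w)) * v 0 = 0 := by
    have : star (w + (1 - star w * w)) = star w + (1 - star w * w) := by simp
    rw [this, add_mul, sub_mul, one_mul, hv0, hfv, sub_self, add_zero]
  have h2 : v 0 = 0 := by rw [← one_mul (v 0), ← huni, mul_assoc, h1, mul_zero]
  rw [← hr 0, h2, mul_zero]

/-- A tracial state of a finite factor is faithful on projections. -/
theorem TracialState.eq_zero_of_isStarProjection (hM : M.IsFactor) (hfin : M.IsFiniteAlg)
    {r : M.Elem} (hr : IsStarProjection r) (hτ : τ.toLinearMap r = 0) : r = 0 := by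
  -- A copy of `r` fits under `1 - e`: otherwise `1 - e` would embed in `r`, leaving a projection of
  -- trace `0 - 1`.
  have step (e : {e : M.Elem // IsStarProjection e ∧ τ.toLinearMap e = 0}) :
      ∃ v : M.Elem, star v * v = r ∧ v * r = v ∧ (e : M.Elem) * v = 0 := by
    obtain ⟨e, he, hτe⟩ := e
    obtain ⟨v, h1, h2, h3⟩ := hM.comparison hr he.one_sub
    have hev : e * v = 0 := by
      rw [sub_mul, one_mul, sub_eq_self] at h1; exact h1
    refine ⟨v, ?_, h2, hev⟩
    rcases h3 with h3 | h3
    · exact h3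
    · exfalso
      have hproj : IsStarProjection (r - star v * v) := by
        have := isStarProjection_sub_mul_star (q := r) (v := star v) hr
          (by simpa [hr.isSelfAdjoint.star_eq] using congrArg star h2)
          (by
            have : v * star v * v = v := by rw [h3, h1]
            simpa [mul_assoc] using congrArg star this)
        simpa using this
      have hneg := τ.re_nonneg_of_isStarProjection hproj
      rw [map_sub, hτ, τ.map_mul_comm, h3, map_sub, τ.map_one, hτe] at hneg
      norm_num at hneg
  choose V hV1 hV2 hV3 using step
  -- Adjoining the new copy keeps the trace zero, so iteration never stops and produces infinitely
  -- many orthogonal copies of `r`.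
  let G : {e : M.Elem // IsStarProjection e ∧ τ.toLinearMap e = 0} →
      {e : M.Elem // IsStarProjection e ∧ τ.toLinearMap e = 0} := fun e =>
    ⟨e + V e * star (V e), by
      refine e.2.1.add (IsStarProjection.mk ?_ (IsSelfAdjoint.mul_star_self _)) ?_
      · change V e * star (V e) * (V e * star (V e)) = V e * star (V e)
        rw [mul_assoc, ← mul_assoc (star (V e)), hV1, ← mul_assoc, hV2]
      · rw [← mul_assoc, hV3, zero_mul], by
      rw [map_add, e.2.2, τ.map_mul_comm, hV1, hτ, add_zero]⟩
  let E : ℕ → {e : M.Elem // IsStarProjection e ∧ τ.toLinearMap e = 0} := fun n =>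
    G^[n] ⟨0, IsStarProjection.zero _, map_zero _⟩
  have hE (n : ℕ) : (E (n + 1) : M.Elem) = E n + V (E n) * star (V (E n)) := by
    simp only [E, Function.iterate_succ_apply']; rfl
  have hVE (n : ℕ) : star (V (E n)) * (E n : M.Elem) = 0 := by
    simpa [(E n).2.1.isSelfAdjoint.star_eq] using congrArg star (hV3 (E n))
  have hlt (m d : ℕ) : (E (m + 1 + d) : M.Elem) * V (E m) = V (E m) := by
    induction d with
    | zero => rw [add_zero, hE, add_mul, hV3, zero_add, mul_assoc, hV1, hV2]
    | succ d ih =>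
      have h1 : star (V (E (m + 1 + d))) * V (E m) = 0 := by
        rw [← ih, ← mul_assoc, hVE, zero_mul]
      rw [← add_assoc, hE, add_mul, ih, mul_assoc, h1, mul_zero, add_zero]
  have horth (m n : ℕ) (h : m < n) : star (V (E n)) * V (E m) = 0 := by
    obtain ⟨d, rfl⟩ := Nat.exists_eq_add_of_le (Nat.succ_le_of_lt h)
    rw [← hlt m d, ← mul_assoc, hVE, zero_mul]
  refine hfin.eq_zero_of_sequence (fun n => V (E n)) (fun n => hV1 _) (fun n => hV2 _) ?_
  intro m n hmn
  rcases lt_or_gt_of_ne hmn with h | h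
  · simpa using congrArg star (horth m n h)
  · exact horth n m h

/-- In a finite factor, projections of equal trace are Murray-von Neumann equivalent. -/
theorem TracialState.exists_equivalence (hM : M.IsFactor) (hfin : M.IsFiniteAlg)
    {p q : M.Elem} (hp : IsStarProjection p) (hq : IsStarProjection q)
    (h : τ.toLinearMap p = τ.toLinearMap q) :
    ∃ v : M.Elem, star v * v = p ∧ v * star v = q ∧ q * v = v := by
  obtain ⟨v, h1, h2, h3⟩ := hM.comparison hp hq
  have hvv : v * star v * v = v := by
    rcases h3 with h3 | h3
    · rw [mul_assoc, h3, h2]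
    · rw [h3, h1]
  have h2' : p * star v = star v := by
    simpa [hp.isSelfAdjoint.star_eq] using congrArg star h2
  have hvv' : star v * star (star v) * star v = star v := by
    simpa [mul_assoc] using congrArg star hvv
  -- One of the two supports is already full; the other falls short by a projection of trace zero.
  rcases h3 with h3 | h3
  · refine ⟨v, h3, ?_, h1⟩
    have := τ.eq_zero_of_isStarProjection hM hfin (isStarProjection_sub_mul_star hq h1 hvv)
      (by rw [map_sub, τ.map_mul_comm, h3, h, sub_self])
    exact (sub_eq_zero.1 this).symm
  · refine ⟨v, ?_, h3, h1⟩
    have := τ.eq_zero_of_isStarProjection hM hfin (isStarProjection_sub_mul_star hp h2' hvv')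
      (by rw [map_sub, star_star, τ.map_mul_comm, h3, h, sub_self])
    rw [star_star] at this
    exact (sub_eq_zero.1 this).symm

end Comparison

/-! ### Encoding blocks in two self-adjoint elements -/

section MatrixUnits

variable {k : ℕ}

theorem aeval_sum_smul {A : Type*} [Ring A] [Algebra ℂ A] {p : Fin k → A} (hidem : ∀ i, p i * p i = p i)
    (horth : ∀ i j, i ≠ j → p i * p j = 0) (hsum : ∑ i, p i = 1) (c : Fin k → ℂ)
    (f : Polynomial ℂ) :
    Polynomial.aeval (∑ i, c i • p i) f = ∑ i, f.eval (c i) • p i := by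
  have hpow (n : ℕ) : (∑ i, c i • p i) ^ n = ∑ i, c i ^ n • p i := by
    induction n with
    | zero => simp [hsum]
    | succ n ih =>
      rw [pow_succ, ih, Finset.sum_mul_sum]
      refine Finset.sum_congr rfl fun i _ => ?_
      rw [Finset.sum_eq_single i]
      · rw [smul_mul_smul_comm, hidem, pow_succ]
      · intro j _ hj
        rw [smul_mul_smul_comm, horth _ _ hj.symm, smul_zero]
      · simp
  induction f using Polynomial.induction_on' with
  | add f g hf hg => simp only [map_add, hf, hg, Polynomial.eval_add, add_smul,
      Finset.sum_add_distrib]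
  | monomial n a =>
    rw [Polynomial.aeval_monomial, hpow, ← Algebra.smul_def, Finset.smul_sum]
    simp [smul_smul]

variable {A : Type*} [Ring A] [StarRing A] [Algebra ℂ A] [StarModule ℂ A]

/-- Two self-adjoint elements encoding a diagonal of orthogonal projections and a family of
strictly upper triangular entries. -/
theorem exists_selfAdjoint_pair_of_entries {p : Fin k → A} (hp : ∀ i, IsStarProjection (p i))
    (horth : ∀ i j, i ≠ j → p i * p j = 0) (hsum : ∑ i, p i = 1) (c : Fin k → Fin k → A)
    (hc : ∀ i j, p i * c i j * p j = c i j) (hc0 : ∀ i j, ¬ i < j → c i j = 0) :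
    ∃ a b : A, IsSelfAdjoint a ∧ IsSelfAdjoint b ∧ ∀ N : StarSubalgebra ℂ A, a ∈ N → b ∈ N →
      (∀ i, p i ∈ N) ∧ ∀ i j, c i j ∈ N := by
  have hidem (i : Fin k) : p i * p i = p i := (hp i).isIdempotentElem.eq
  have hC (i j : Fin k) : p i * (∑ i', ∑ j', c i' j') * p j = c i j := by
    have h0 (i' j' : Fin k) (h : i' ≠ i ∨ j' ≠ j) : p i * c i' j' * p j = 0 := by
      rw [← hc i' j']
      rcases h with h | h
      · rw [← mul_assoc, ← mul_assoc, horth _ _ h.symm]; simp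
      · rw [mul_assoc, mul_assoc _ (p j'), horth _ _ h]; simp
    simp only [Finset.mul_sum, Finset.sum_mul]
    rw [Finset.sum_eq_single i, Finset.sum_eq_single j, hc]
    · exact fun j' _ hj' => h0 _ _ (Or.inr hj')
    · simp
    · exact fun i' _ hi' => Finset.sum_eq_zero fun j' _ => h0 _ _ (Or.inl hi')
    · simp
  -- The coefficients are real, making `a` self-adjoint, and distinct, so that Lagrange polynomials
  -- in `a` isolate each `p i`.
  let lam : Fin k → ℂ := fun i => ((i : ℕ) : ℂ)
  have hlam : Function.Injective lam := fun i j h => Fin.ext (Nat.cast_injective h)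
  refine ⟨∑ i, lam i • p i, (∑ i, ∑ j, c i j) + star (∑ i, ∑ j, c i j), ?_,
    IsSelfAdjoint.add_star_self _, ?_⟩
  · change star (∑ i, lam i • p i) = _
    simp [lam, star_sum, (hp _).isSelfAdjoint.star_eq]
  · intro N ha hb
    have hpN (i : Fin k) : p i ∈ N := by
      classical
      have h1 := aeval_sum_smul hidem horth hsum lam
        (Lagrange.interpolate Finset.univ lam (Pi.single i 1))
      have h2 : Polynomial.aeval (∑ i, lam i • p i)
          (Lagrange.interpolate Finset.univ lam (Pi.single i 1)) = p i := by
        rw [h1, Finset.sum_eq_single i]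
        · rw [Lagrange.eval_interpolate_at_node _ hlam.injOn (Finset.mem_univ i)]; simp
        · intro j _ hj
          rw [Lagrange.eval_interpolate_at_node _ hlam.injOn (Finset.mem_univ j)]; simp [hj]
        · simp
      rw [← h2]
      have h3 := Polynomial.aeval_subalgebra_coe
        (Lagrange.interpolate Finset.univ lam (Pi.single i 1)) N.toSubalgebra ⟨_, ha⟩
      exact h3 ▸ SetLike.coe_mem _
    refine ⟨hpN, fun i j => ?_⟩
    by_cases hij : i < j
    -- The adjoint is strictly lower triangular and so does not interfere with the entries above the
    -- diagonal.
    · have h1 : p i * star (∑ i, ∑ j, c i j) * p j = 0 := by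
        have := congrArg star (hC j i)
        rw [hc0 j i hij.not_gt] at this
        simpa [(hp _).isSelfAdjoint.star_eq, mul_assoc] using this
      have h2 : p i * ((∑ i, ∑ j, c i j) + star (∑ i, ∑ j, c i j)) * p j = c i j := by
        rw [mul_add, add_mul, hC, h1, add_zero]
      rw [← h2]
      exact mul_mem (mul_mem (hpN i) hb) (hpN j)
    · rw [hc0 i j hij]
      exact zero_mem N

/-- Given a system of matrix units, elements with few nonzero blocks lie in the algebra generated
by two self-adjoint elements. -/
theorem exists_selfAdjoint_pair_of_blocks {n : ℕ} {p u : Fin k → A} {r : A}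
    (hp : ∀ i, IsStarProjection (p i)) (horth : ∀ i j, i ≠ j → p i * p j = 0)
    (hsum : ∑ i, p i = 1) (hu : ∀ i, star (u i) * u i = r) (hu' : ∀ i, u i * star (u i) = p i)
    (hpu : ∀ i, p i * u i = u i) (x : Fin n → A)
    (σ : (Σ m, {ij : Fin k × Fin k // p ij.1 * x m * p ij.2 ≠ 0}) → Fin k × Fin k)
    (hσ : Function.Injective σ) (hσ' : ∀ t, ((σ t).1 : ℕ) + 1 < (σ t).2) :
    ∃ a b : A, IsSelfAdjoint a ∧ IsSelfAdjoint b ∧ ∀ N : StarSubalgebra ℂ A, a ∈ N → b ∈ N →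
      ∀ m, x m ∈ N := by
  have hup (i : Fin k) : star (u i) * p i = star (u i) := by
    simpa [(hp i).isSelfAdjoint.star_eq] using congrArg star (hpu i)
  have hur (i : Fin k) : u i * r = u i := by rw [← hu i, ← mul_assoc, hu', hpu]
  have hru (i : Fin k) : r * star (u i) = star (u i) := by
    rw [← hu i, mul_assoc, hu', hup]
  -- `g t` is the block `t` transported to the slot `σ t`. In `c` the superdiagonal holds the matrix
  -- units, and `hσ'` keeps the slots off it.
  let g : (Σ m, {ij : Fin k × Fin k // p ij.1 * x m * p ij.2 ≠ 0}) → A := fun t =>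
    u (σ t).1 * star (u t.2.1.1) * x t.1 * (u t.2.1.2 * star (u (σ t).2))
  let c : Fin k → Fin k → A := fun i j =>
    if (i : ℕ) + 1 = j then u i * star (u j) else Function.extend σ g (0 : Fin k × Fin k → A) (i, j)
  have hcσ (t) : c (σ t).1 (σ t).2 = g t := by
    simp only [c, (hσ' t).ne, if_false]
    exact hσ.extend_apply g (0 : Fin k × Fin k → A) t
  have hc' (i j : Fin k) (h1 : (i : ℕ) + 1 ≠ j) (h2 : ¬ ∃ t, σ t = (i, j)) : c i j = 0 := by
    simp only [c, h1, if_false]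
    exact Function.extend_apply' g (0 : Fin k × Fin k → A) _ h2
  have hc1 (i j : Fin k) (h : (i : ℕ) + 1 = j) : c i j = u i * star (u j) := by
    simp only [c, h, if_true]
  have hcp (i j : Fin k) : p i * c i j * p j = c i j := by
    by_cases h1 : (i : ℕ) + 1 = j
    · rw [hc1 i j h1, ← mul_assoc, hpu, mul_assoc, hup]
    · by_cases h2 : ∃ t, σ t = (i, j)
      · obtain ⟨t, ht⟩ := h2
        obtain ⟨rfl, rfl⟩ := Prod.ext_iff.1 ht
        rw [hcσ]
        simp only [g, ← mul_assoc, hpu]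
        rw [mul_assoc _ (star _), hup]
      · rw [hc' i j h1 h2]; simp
  have hc0 (i j : Fin k) (h : ¬ i < j) : c i j = 0 := by
    refine hc' i j (fun h1 => h (Fin.lt_def.2 (by omega))) ?_
    rintro ⟨t, ht⟩
    obtain ⟨rfl, rfl⟩ := Prod.ext_iff.1 ht
    have := hσ' t
    exact h (Fin.lt_def.2 (by omega))
  obtain ⟨a, b, ha, hb, hN⟩ := exists_selfAdjoint_pair_of_entries hp horth hsum c hcp hc0
  refine ⟨a, b, ha, hb, fun N haN hbN => ?_⟩
  obtain ⟨hpN, hcN⟩ := hN N haN hbN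
  -- A matrix unit at distance `d` above the diagonal is a product of `d` superdiagonal ones.
  have hle (d : ℕ) (i j : Fin k) (h : (i : ℕ) + d = j) : u i * star (u j) ∈ N := by
    induction d generalizing j with
    | zero =>
      obtain rfl : i = j := Fin.ext (by omega)
      rw [hu']; exact hpN i
    | succ d ih =>
      let j' : Fin k := ⟨i + d, by omega⟩
      have h1 := mul_mem (ih j' rfl) (hcN j' j)
      rw [hc1 j' j (by simp only [j']; omega), mul_assoc, ← mul_assoc (star _), hu, hru] at h1
      exact h1
  have huN (i j : Fin k) : u i * star (u j) ∈ N := by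
    rcases le_total i j with h | h
    · exact hle (j - i) i j (by have := Fin.le_def.1 h; omega)
    · have := star_mem (hle (i - j) j i (by have := Fin.le_def.1 h; omega))
      simpa using this
  have hblock (m : Fin n) (i j : Fin k) : p i * x m * p j ∈ N := by
    by_cases h : p i * x m * p j = 0
    · rw [h]; exact zero_mem N
    · let t : Σ m, {ij : Fin k × Fin k // p ij.1 * x m * p ij.2 ≠ 0} := ⟨m, (i, j), h⟩
      have h1 : g t ∈ N := hcσ t ▸ hcN _ _
      have h2 : u i * star (u (σ t).1) * g t * (u (σ t).2 * star (u j)) = p i * x m * p j := by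
        calc u i * star (u (σ t).1) * (u (σ t).1 * star (u i) * x m * (u j * star (u (σ t).2)))
              * (u (σ t).2 * star (u j))
            = u i * (star (u (σ t).1) * u (σ t).1) * star (u i) * x m *
              (u j * (star (u (σ t).2) * u (σ t).2) * star (u j)) := by simp only [mul_assoc]
          _ = p i * x m * p j := by rw [hu, hu, hur, hur, hu', hu']
      rw [← h2]
      exact mul_mem (mul_mem (huN _ _) h1) (huN _ _)
  intro m
  have : x m = ∑ i, ∑ j, p i * x m * p j := by
    simp only [← Finset.mul_sum, ← Finset.sum_mul, hsum, one_mul, mul_one]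
  rw [this]
  exact sum_mem fun i _ => sum_mem fun j _ => hblock m i j

/-- With `(k-1)(k-2)/2` slots the claim is `k² - 6k + 4 ≥ 0`, which fails at `k = 5` and holds from
`6` on. -/
theorem sq_le_four_mul_card_slots (hk : 6 ≤ k) :
    k ^ 2 ≤ 4 * Fintype.card {ij : Fin k × Fin k // (ij.1 : ℕ) + 1 < ij.2} := by
  -- Column `j` has the rows `i < j - 1`; truncated subtraction rightly gives none for `j = 0`.
  have h1 : Fintype.card {ij : Fin k × Fin k // (ij.1 : ℕ) + 1 < ij.2} =
      ∑ j ∈ Finset.range k, (j - 1) := by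
    rw [Fintype.card_subtype, ← Fin.sum_univ_eq_sum_range, Finset.card_filter,
      Fintype.sum_prod_type_right]
    refine Finset.sum_congr rfl fun j _ => ?_
    have h2 : ∀ i : Fin k, ((i : ℕ) + 1 < j) ↔ (i : ℕ) ∈ Finset.range (j - 1) := by
      intro i; rw [Finset.mem_range]; omega
    simp only [h2]
    rw [Fin.sum_univ_eq_sum_range (fun i => if i ∈ Finset.range (j - 1) then 1 else 0) k,
      ← Finset.card_filter, Finset.filter_mem_eq_inter, Finset.inter_eq_right.2, Finset.card_range]
    exact Finset.range_subset_range.2 (by omega)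
  have h2 (m : ℕ) : 2 * ∑ j ∈ Finset.range (m + 2), (j - 1) = m * (m + 1) := by
    induction m with
    | zero => rfl
    | succ m ih =>
      rw [Finset.sum_range_succ, mul_add, ih]
      simp only [Nat.add_succ_sub_one]
      ring
  obtain ⟨m, rfl⟩ := Nat.exists_eq_add_of_le' (show 2 ≤ k by omega)
  have h3 := h2 m
  rw [h1]
  nlinarith

end MatrixUnits

/-! ### From few blocks to generators -/

section Generators

variable {H : Type*} [NormedAddCommGroup H] [InnerProductSpace ℂ H] [CompleteSpace H]
variable {M : VonNeumannAlgebra H}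

/-- This reduces generation to pure algebra: no closure is needed, since the old generators lie in
the *-algebra generated by the new ones. -/
theorem isGeneratedBy_of_forall_starSubalgebra {S T : Set M.Elem} (hS : M.IsGeneratedBy S)
    (h : ∀ N : StarSubalgebra ℂ M.Elem, T ⊆ N → S ⊆ N) : M.IsGeneratedBy T := by
  intro N hN
  exact hS N fun x hx => h (N.toStarSubalgebra.comap M.toStarSubalgebra.subtype) hN hx

theorem isGeneratedBy_singleton_of_pair {a b : M.Elem} (ha : IsSelfAdjoint a)
    (hb : IsSelfAdjoint b) (h : M.IsGeneratedBy {a, b}) :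
    M.IsGeneratedBy {a + Complex.I • b} := by
  refine isGeneratedBy_of_forall_starSubalgebra h fun N hN => ?_
  have hx : a + Complex.I • b ∈ N := hN rfl
  have hx' : a - Complex.I • b ∈ N := by
    have := star_mem hx
    simpa [ha.star_eq, hb.star_eq, sub_eq_add_neg] using this
  have haN : (1 / 2 : ℂ) • ((a + Complex.I • b) + (a - Complex.I • b)) = a := by module
  have hbN : (-Complex.I / 2) • ((a + Complex.I • b) - (a - Complex.I • b)) = b := by
    have : (a + Complex.I • b) - (a - Complex.I • b) = (2 * Complex.I) • b := by module
    rw [this, smul_smul]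
    have : -Complex.I / 2 * (2 * Complex.I) = 1 := by
      linear_combination -Complex.I_mul_I
    rw [this, one_smul]
  rintro y (rfl | rfl)
  · rw [← haN]; exact N.smul_mem (add_mem hx hx') _
  · rw [← hbN]; exact N.smul_mem (sub_mem hx hx') _

/-- A generating tuple with fewer than `k² / 4` nonzero blocks can be replaced by two self-adjoint
elements. -/
theorem exists_selfAdjoint_pair_of_card_lt (hM : M.IsFactor) (hfin : M.IsFiniteAlg)
    (τ : M.TracialState) {k n : ℕ} (hk : 6 ≤ k) {p : Fin k → M.Elem} (hp : p ∈ M.equalFamilies τ k)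
    {x : Fin n → M.Elem} (hx : M.IsGeneratedBy (Set.range x))
    (hcard : 4 * ∑ m, Nat.card {ij : Fin k × Fin k // p ij.1 * x m * p ij.2 ≠ 0} < k ^ 2) :
    ∃ a b : M.Elem, IsSelfAdjoint a ∧ IsSelfAdjoint b ∧ M.IsGeneratedBy {a, b} := by
  classical
  obtain ⟨hproj, horth, htr⟩ := hp
  have hk0 : (k : ℂ) ≠ 0 := by exact_mod_cast (by omega : k ≠ 0)
  have hsum : ∑ i, p i = 1 := by
    have h1 : IsStarProjection (∑ i, p i) := by
      refine IsStarProjection.mk ?_ ?_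
      · change (∑ i, p i) * (∑ i, p i) = ∑ i, p i
        rw [Finset.sum_mul_sum]
        refine Finset.sum_congr rfl fun i _ => ?_
        rw [Finset.sum_eq_single i]
        · exact (hproj i).isIdempotentElem.eq
        · exact fun j _ hj => horth _ _ hj.symm
        · simp
      · change star (∑ i, p i) = _
        simp [star_sum, (hproj _).isSelfAdjoint.star_eq]
    -- The complement of `∑ i, p i` has trace `1 - k * (1/k) = 0`.
    have h2 := τ.eq_zero_of_isStarProjection hM hfin h1.one_sub (by
      rw [map_sub, map_sum, τ.map_one]
      simp [htr, hk0])
    exact (sub_eq_zero.1 h2).symm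
  let o : Fin k := ⟨0, by omega⟩
  choose u hu hu' hpu using fun i => τ.exists_equivalence hM hfin (hproj o) (hproj i)
    (by rw [htr, htr])
  have hσ : Nonempty ((Σ m, {ij : Fin k × Fin k // p ij.1 * x m * p ij.2 ≠ 0}) ↪
      {ij : Fin k × Fin k // (ij.1 : ℕ) + 1 < ij.2}) := by
    refine Function.Embedding.nonempty_of_card_le ?_
    have h1 := sq_le_four_mul_card_slots hk
    rw [← Nat.card_eq_fintype_card, Nat.card_sigma]
    omega
  obtain ⟨σ⟩ := hσ
  obtain ⟨a, b, ha, hb, hN⟩ := exists_selfAdjoint_pair_of_blocks hproj horth hsum hu hu' hpu x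
    (fun t => (σ t : Fin k × Fin k)) (Subtype.val_injective.comp σ.injective) fun t => (σ t).2
  refine ⟨a, b, ha, hb, isGeneratedBy_of_forall_starSubalgebra hx fun N hab => ?_⟩
  rintro _ ⟨m, rfl⟩
  exact hN N (hab (Or.inl rfl)) (hab (Or.inr rfl)) m

theorem four_mul_card_lt_of_sum_matricialSize_lt {k n : ℕ} (hk : k ≠ 0) {p : Fin k → M.Elem}
    {x : Fin n → M.Elem} (h : ∑ m, M.matricialSize (x m) p < 1 / 4) :
    4 * ∑ m, Nat.card {ij : Fin k × Fin k // p ij.1 * x m * p ij.2 ≠ 0} < k ^ 2 := by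
  have hk0 : ((k : ℝ≥0∞)) ^ 2 ≠ 0 := by simpa using hk
  have hk1 : ((k : ℝ≥0∞)) ^ 2 ≠ ⊤ := by simp
  simp only [matricialSize, div_eq_mul_inv, ← Finset.sum_mul] at h
  rw [← div_eq_mul_inv, ENNReal.div_lt_iff (Or.inl hk0) (Or.inl hk1), one_mul, mul_comm,
    ← div_eq_mul_inv, ENNReal.lt_div_iff_mul_lt (Or.inl (by norm_num)) (Or.inl (by norm_num)),
    mul_comm] at h
  exact_mod_cast h

end Generators

end VonNeumannAlgebra

theorem theorem4p2 {H : Type*} [NormedAddCommGroup H] [InnerProductSpace ℂ H] [CompleteSpace H]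
    (M : VonNeumannAlgebra H) (hM : M.IsTypeIIOneFactor) (τ : M.TracialState)
    (hG : M.genInvariant τ < 1 / 4) :
    M.IsSinglyGenerated ∧
      ∃ a b : M.Elem, IsSelfAdjoint a ∧ IsSelfAdjoint b ∧ M.IsGeneratedBy {a, b} := by
  obtain ⟨k, hk, hk6⟩ := ((Filter.frequently_lt_of_liminf_lt (h := hG)).and_eventually
    (Filter.eventually_ge_atTop 6)).exists
  simp only [VonNeumannAlgebra.genInvariantAt, VonNeumannAlgebra.tupleSize, iInf_lt_iff] at hk
  obtain ⟨n, x, hx, p, hp, hlt⟩ := hk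
  obtain ⟨a, b, ha, hb, hab⟩ := VonNeumannAlgebra.exists_selfAdjoint_pair_of_card_lt hM.isFactor
    hM.isFiniteAlg τ hk6 hp hx
    (VonNeumannAlgebra.four_mul_card_lt_of_sum_matricialSize_lt (by omega) hlt)
  exact ⟨⟨_, VonNeumannAlgebra.isGeneratedBy_singleton_of_pair ha hb hab⟩, a, b, ha, hb, hab⟩
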